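/- Let $G$ be a group generated by a finite subset $S$. Let $N_0\supseteq N_1\supseteq\cdots$ be a nested sequence of finite index normal subgroups of $G$ with $\bigcap_{n} N_n=\{e\}$. The box space of $G$ associated to $S$ and $(N_n)$ is the sequence of finite metric spaces $(X_n,d_n)=(G/N_n,d_{S_n})$, where $S_n$ is the image of $S$ in $G/N_n$ and $d_{S_n}$ is the word metric, i.e. the graph metric of the Cayley graph of $(G/N_n,S_n)$. A coarse embedding of a sequence $(X_n,d_n)$ into a metric space $(Y,d_Y)$ is a sequence of maps $\phi_n\colon X_n\to Y$ for which there exist two proper functions $\rho,\gamma\colon[0,\infty)\to[0,\infty)$, independent of $n$, with $\rho(d_n(x,y))\le d_Y(\phi_n(x),\phi_n(y))\le\gamma(d_n(x,y))$ for all $n$ and all $x,y\in X_n$. (1) Suppose that $G$ does not have the Haagerup property, that is, $G$ admits no metrically proper affine isometric action on a Hilbert space (an action $\sigma$ with $\|\sigma(g)0\|\to\infty$ as $g\to\infty$ in the discrete group $G$). Then, for every $(N_n)$ as above, the box space of $G$ associated to $S$ and $(N_n)$ does not coarsely embed into any Hilbert space. (2) Suppose that $G$ has an infinite subset $Y$ such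 that the pair $(G,Y)$ has relative Property T, that is, for every orthogonal representation $\pi$ of $G$ on a Hilbert space and every sequence of unit vectors $v_n$ with $\|\pi(g)v_n-v_n\|\to0$ for each $g\in G$, one has $\sup_{y\in Y}\|\pi(y)v_n-v_n\|\to0$. Then, for every $(N_n)$ as above, the box space of $G$ associated to $S$ and $(N_n)$ does not coarsely embed into any Hilbert space. -/

import Mathlib

open Filter Topology
open scoped NNReal

universe u w

/-- The word metric of the Cayley graph of `Q` with respect to `S` (edges join `g` and `g * s`,
`s ∈ S`); it is a genuine metric as soon as `S` generates `Q`. -/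
noncomputable def cayleyDist {Q : Type*} [Group Q] (S : Set Q) (x y : Q) : ℕ :=
  (SimpleGraph.mulCayley S).dist x y

/-- A function `[0, ∞) → [0, ∞)` is proper if preimages of bounded sets are bounded, that is,
if it tends to `∞` at `∞`. -/
def IsProperControl (ρ : ℝ≥0 → ℝ≥0) : Prop := Tendsto ρ atTop atTop

/-- The maps `φ n : X n → Y` form a coarse embedding of the sequence of graph-metric spaces
`(X n, d n)` into `Y`: there are two proper functions `ρ, γ`, common to all `n`, with
`ρ (d n x y) ≤ dist (φ n x) (φ n y) ≤ γ (d n x y)`. -/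
def IsCoarseEmbedding {X : ℕ → Type*} (d : ∀ n, X n → X n → ℕ)
    {Y : Type*} [MetricSpace Y] (φ : ∀ n, X n → Y) : Prop :=
  ∃ ρ γ : ℝ≥0 → ℝ≥0, IsProperControl ρ ∧ IsProperControl γ ∧
    ∀ (n : ℕ) (x y : X n),
      ρ (d n x y) ≤ nndist (φ n x) (φ n y) ∧ nndist (φ n x) (φ n y) ≤ γ (d n x y)

/-- A nested sequence of finite index normal subgroups with trivial intersection. -/
structure IsBoxSequence {G : Type*} [Group G] (N : ℕ → Subgroup G) [∀ n, (N n).Normal] :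
    Prop where
  finiteIndex : ∀ n, (N n).FiniteIndex
  nested : Antitone N
  iInf_eq_bot : ⨅ n, N n = ⊥

/-- The metrics of the box space of `G` associated to `S` and `N`: the `n`-th space is `G ⧸ N n`
with the word metric of the image of `S`. -/
noncomputable def boxSpaceDist {G : Type*} [Group G] (S : Set G) (N : ℕ → Subgroup G)
    [∀ n, (N n).Normal] (n : ℕ) : G ⧸ N n → G ⧸ N n → ℕ :=
  cayleyDist ((fun g : G => (g : G ⧸ N n)) '' S)

/-- The box space of `G` associated to `S` and `N` coarsely embeds into some Hilbert space
(in the universe `w`). Complex Hilbert spaces are covered, as they are real Hilbert spaces by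
restriction of scalars. -/
def BoxSpaceEmbedsInHilbert {G : Type u} [Group G] (S : Set G) (N : ℕ → Subgroup G)
    [∀ n, (N n).Normal] : Prop :=
  ∃ (H : Type w) (_ : NormedAddCommGroup H) (_ : InnerProductSpace ℝ H) (_ : CompleteSpace H)
    (φ : ∀ n, G ⧸ N n → H), IsCoarseEmbedding (boxSpaceDist S N) φ

/-- The Haagerup property of a discrete group: there is a metrically proper affine isometric
action `σ` on a Hilbert space. Writing `σ g v = π g v + b g`, the cocycle is `b g = σ g 0`, and
the action is metrically proper if `‖b g‖ → ∞` as `g` leaves finite subsets of `G`.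
For countable `G`, Hilbert spaces in the universe of `G` suffice, since one may restrict to a
separable invariant subspace. -/
def HaagerupProperty (G : Type u) [Group G] : Prop :=
  ∃ (H : Type u) (_ : NormedAddCommGroup H) (_ : InnerProductSpace ℝ H) (_ : CompleteSpace H)
    (σ : G →* (H ≃ᵃⁱ[ℝ] H)), Tendsto (fun g : G => ‖σ g 0‖) cofinite atTop

/-- Relative Property T of the pair `(G, Y)`: for every orthogonal representation `π` of `G` on a
Hilbert space and every almost invariant sequence of unit vectors `v n`, the convergence
`‖π g (v n) - v n‖ → 0` is uniform for `g ∈ Y`. -/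
def RelativePropertyT (G : Type u) [Group G] (Y : Set G) : Prop :=
  ∀ (H : Type u) [NormedAddCommGroup H] [InnerProductSpace ℝ H] [CompleteSpace H]
    (π : G →* (H ≃ₗᵢ[ℝ] H)) (v : ℕ → H), (∀ n, ‖v n‖ = 1) →
    (∀ g : G, Tendsto (fun n => ‖π g (v n) - v n‖) atTop (𝓝 0)) →
    TendstoUniformlyOn (fun n g => ‖π g (v n) - v n‖) (fun _ => 0) atTop Y

/-! Both claims follow from one implication: a Hilbert space embedding of the box space forces the
Haagerup property. For an embedding `φ` of a finite quotient, average over all base points `x` the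
Gram kernels of `g ↦ φ (x * f g) - φ x`. Right translation permutes the quotient, so the average
satisfies the cocycle identity exactly. The upper control bounds these kernels uniformly in `n`; an
ultralimit is a positive semidefinite kernel on `G`, and the affine GNS construction turns it into
an affine action. The lower control, with finiteness of balls in `G`, makes that action proper.

For (2), Gaussian kernels of a proper cocycle give almost invariant unit vectors that are moved far
by all but finitely many elements. -/

/-! ### Positive semidefinite kernels and GNS constructions -/

section Kernels

open scoped InnerProductSpace

/-- Entrywise limits of positive semidefinite kernels are positive semidefinite. -/
theorem Matrix.PosSemidef.of_tendsto {X ι : Type*} {l : Filter ι} [l.NeBot]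
    {K : ι → Matrix X X ℝ} {K' : Matrix X X ℝ} (hK : ∀ i, (K i).PosSemidef)
    (hlim : ∀ x y, Tendsto (fun i => K i x y) l (𝓝 (K' x y))) : K'.PosSemidef := by
  refine ⟨?_, fun c => ?_⟩
  · ext x y
    refine tendsto_nhds_unique (hlim y x) ((hlim x y).congr fun i => ?_)
    simpa using (hK i).isHermitian.apply y x
  · refine ge_of_tendsto' (x := l) (f := fun i =>
      c.sum fun x a => c.sum fun y b => star a * K i x y * b) ?_ fun i => (hK i).2 c
    refine tendsto_finsetSum _ fun x _ => tendsto_finsetSum _ fun y _ => ?_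
    exact ((hlim x y).const_mul _).mul_const _

/-- Gram matrices of arbitrary families are positive semidefinite. -/
theorem Matrix.posSemidef_gram_real {X H : Type*} [NormedAddCommGroup H] [InnerProductSpace ℝ H]
    (v : X → H) : (Matrix.gram ℝ v).PosSemidef := by
  refine ⟨Matrix.isHermitian_gram ℝ v, fun c => ?_⟩
  have h : (c.sum fun x a => c.sum fun y b => star a * Matrix.gram ℝ v x y * b) =
      ⟪c.sum fun x a => a • v x, c.sum fun x a => a • v x⟫_ℝ := by
    simp only [Finsupp.sum, sum_inner, inner_sum, real_inner_smul_left, real_inner_smul_right,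
      Matrix.gram_apply, star_trivial]
    exact Finset.sum_congr rfl fun x _ => Finset.sum_congr rfl fun y _ => by
      rw [real_inner_comm]; ring
  rw [h]
  exact real_inner_self_nonneg

/-- The entrywise exponential of a positive semidefinite kernel is positive semidefinite. -/
theorem Matrix.PosSemidef.map_exp {X : Type*} {K : Matrix X X ℝ} (hK : K.PosSemidef) :
    (K.map Real.exp).PosSemidef := by
  have hpow : ∀ n : ℕ, (K.map (· ^ n)).PosSemidef := by
    intro n
    induction n with
    | zero =>
      convert Matrix.posSemidef_gram_real (fun _ : X => (1 : ℝ)) using 1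
      ext x y
      simp
    | succ n ih =>
      have h : K.map (· ^ (n + 1)) = (K.map (· ^ n)).hadamard K := by
        ext x y
        simp [pow_succ]
      rw [h]
      exact ih.hadamard hK
  refine .of_tendsto (l := atTop)
    (K := fun n : ℕ => ∑ i ∈ Finset.range n, ((i.factorial : ℝ)⁻¹) • K.map (· ^ i))
    (fun n => Matrix.posSemidef_sum _ fun i _ => (hpow i).smul (by positivity)) fun x y => ?_
  have h := (NormedSpace.expSeries_div_hasSum_exp (K x y)).tendsto_sum_nat
  rw [← Real.exp_eq_exp_ℝ] at h
  refine h.congr fun n => ?_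
  simp [Matrix.sum_apply, div_eq_inv_mul]

/-- Schoenberg: the Gaussian kernel `exp (-‖v x - v y‖ ^ 2)` is positive semidefinite. -/
theorem posSemidef_gaussian {X H : Type*} [NormedAddCommGroup H] [InnerProductSpace ℝ H]
    (v : X → H) : (Matrix.of fun x y => Real.exp (-‖v x - v y‖ ^ 2)).PosSemidef := by
  -- Expand the square: the factor `exp (2⟪v x, v y⟫)` times a rank-one kernel.
  have h1 := ((Matrix.posSemidef_gram_real v).smul (zero_le_two (α := ℝ))).map_exp
  have h2 := Matrix.posSemidef_gram_real fun x => Real.exp (-‖v x‖ ^ 2)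
  suffices h : (Matrix.of fun x y => Real.exp (-‖v x - v y‖ ^ 2)) =
      (((2 : ℝ) • Matrix.gram ℝ v).map Real.exp).hadamard
        (Matrix.gram ℝ fun x => Real.exp (-‖v x‖ ^ 2)) by
    rw [h]
    exact h1.hadamard h2
  ext x y
  simp only [Matrix.of_apply, Matrix.hadamard_apply, Matrix.map_apply, Matrix.smul_apply,
    Matrix.gram_apply, smul_eq_mul, RCLike.inner_apply, conj_trivial, ← Real.exp_add,
    norm_sub_sq_real]
  ring_nf

/-- Moore–Aronszajn: a positive semidefinite kernel is the Gram matrix of a total family. -/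
theorem Matrix.PosSemidef.exists_gram {X : Type u} {K : Matrix X X ℝ} (hK : K.PosSemidef) :
    ∃ (H : Type u) (_ : NormedAddCommGroup H) (_ : InnerProductSpace ℝ H) (_ : CompleteSpace H)
      (v : X → H), DenseRange (Finsupp.linearCombination ℝ v) ∧ ∀ x y, ⟪v x, v y⟫_ℝ = K x y := by
  let K' : Matrix X X (ℝ →L[ℝ] ℝ) := K.map fun a => a • (1 : ℝ →L[ℝ] ℝ)
  have hK' : K'.PosSemidef := by
    refine ((RKHS.posSemidef_tfae (K := K')).out 0 2 rfl rfl).mpr ⟨?_, fun c => ?_⟩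
    · ext x y
      have h := hK.isHermitian.apply x y
      simp only [star_trivial] at h
      simp [K', h]
    · have h := hK.2 c
      rw [Finsupp.sum_comm] at h
      simpa [K', mul_comm, mul_left_comm] using h
  have : Fact K'.PosSemidef := ⟨hK'⟩
  refine ⟨RKHS.OfKernel K', inferInstance, inferInstance, inferInstance,
    fun x => RKHS.kerFun (RKHS.OfKernel K') x 1, ?_, fun x y => ?_⟩
  · have h := RKHS.kerFun_dense (RKHS.OfKernel K')
    rw [← Submodule.dense_iff_topologicalClosure_eq_top] at h
    refine Dense.mono ?_ h
    rw [← LinearMap.coe_range, Finsupp.range_linearCombination, SetLike.coe_subset_coe,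
      Submodule.span_le]
    rintro _ ⟨x, a, rfl⟩
    have ha : RKHS.kerFun (RKHS.OfKernel K') x a = a • RKHS.kerFun (RKHS.OfKernel K') x 1 := by
      rw [← map_smul, smul_eq_mul, mul_one]
    rw [ha]
    exact Submodule.smul_mem _ _ (Submodule.subset_span ⟨x, rfl⟩)
  · rw [← RKHS.kernel_inner, RKHS.OfKernel.kernel_ofKernel]
    have h := hK.isHermitian.apply x y
    simp only [star_trivial] at h
    simp [K', h]

/-- Two families with the same Gram matrix, the first total, are related by a linear isometry. -/
theorem exists_linearIsometry_of_gram_eq {X H H' : Type*} [NormedAddCommGroup H]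
    [InnerProductSpace ℝ H] [NormedAddCommGroup H'] [InnerProductSpace ℝ H'] [CompleteSpace H']
    {v : X → H} {w : X → H'} (hv : DenseRange (Finsupp.linearCombination ℝ v))
    (h : ∀ x y, ⟪w x, w y⟫_ℝ = ⟪v x, v y⟫_ℝ) : ∃ T : H →ₗᵢ[ℝ] H', ∀ x, T (v x) = w x := by
  have hnorm : ∀ c, ‖Finsupp.linearCombination ℝ w c‖ = ‖Finsupp.linearCombination ℝ v c‖ := by
    intro c
    rw [← sq_eq_sq₀ (norm_nonneg _) (norm_nonneg _), ← real_inner_self_eq_norm_sq,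
      ← real_inner_self_eq_norm_sq]
    simp only [Finsupp.linearCombination_apply, Finsupp.sum, sum_inner, inner_sum,
      real_inner_smul_left, real_inner_smul_right, h]
  have hbound : ∀ c, ‖Finsupp.linearCombination ℝ w c‖ ≤
      1 * ‖Finsupp.linearCombination ℝ v c‖ := fun c => by rw [hnorm, one_mul]
  let T := (Finsupp.linearCombination ℝ w).extendOfNorm (Finsupp.linearCombination ℝ v)
  have hT : ∀ c, T (Finsupp.linearCombination ℝ v c) = Finsupp.linearCombination ℝ w c :=
    LinearMap.extendOfNorm_eq hv ⟨1, hbound⟩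
  refine ⟨⟨T.toLinearMap, fun y => ?_⟩, fun x => ?_⟩
  · refine hv.induction (P := fun y => ‖T y‖ = ‖y‖) ?_
      (isClosed_eq (by fun_prop) (by fun_prop)) y
    rintro _ ⟨c, rfl⟩
    rw [hT, hnorm]
  · simpa using hT (Finsupp.single x 1)

/-- Linear isometries agreeing on a total family are equal. -/
theorem LinearIsometry.ext_of_denseRange {X H H' : Type*} [NormedAddCommGroup H]
    [InnerProductSpace ℝ H] [NormedAddCommGroup H'] [InnerProductSpace ℝ H']
    {v : X → H} (hv : DenseRange (Finsupp.linearCombination ℝ v)) {T T' : H →ₗᵢ[ℝ] H'}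
    (h : ∀ x, T (v x) = T' (v x)) : T = T' := by
  refine DFunLike.coe_injective (hv.equalizer T.continuous T'.continuous ?_)
  ext c
  simp only [Function.comp_apply, Finsupp.linearCombination_apply, map_finsuppSum, map_smul, h]

/-- A family of Gram-matrix preserving substitutions `v x ↦ w g x`, compatible with the group
law, extends to an orthogonal representation. -/
theorem exists_representation_of_gram_eq {G X H : Type*} [Group G] [NormedAddCommGroup H]
    [InnerProductSpace ℝ H] [CompleteSpace H] {v : X → H} {w : G → X → H}
    (hv : DenseRange (Finsupp.linearCombination ℝ v))
    (hgram : ∀ g x y, ⟪w g x, w g y⟫_ℝ = ⟪v x, v y⟫_ℝ) (hone : w 1 = v)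
    (hmul : ∀ g h (T : H →ₗᵢ[ℝ] H), (∀ x, T (v x) = w g x) → ∀ x, T (w h x) = w (g * h) x) :
    ∃ π : G →* (H ≃ₗᵢ[ℝ] H), ∀ g x, π g (v x) = w g x := by
  choose T hT using fun g => exists_linearIsometry_of_gram_eq hv (hgram g)
  have hT1 : T 1 = 1 := LinearIsometry.ext_of_denseRange hv fun x => by simp [hT, hone]
  have hTmul : ∀ g h, T (g * h) = T g * T h := fun g h =>
    LinearIsometry.ext_of_denseRange hv fun x => by
      rw [hT, LinearIsometry.coe_mul, Function.comp_apply, hT, hmul g h (T g) (hT g)]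
  have hinv : ∀ g y, T g (T g⁻¹ y) = y := fun g y => by
    have := congrArg (fun F => F y) (hTmul g g⁻¹)
    simpa [hT1] using this.symm
  refine ⟨{
    toFun := fun g => LinearIsometryEquiv.ofSurjective (T g) fun y => ⟨_, hinv g y⟩
    map_one' := ?_
    map_mul' := fun g h => ?_ }, fun g x => hT g x⟩
  · ext y
    simp [hT1]
  · ext y
    simp only [hTmul]
    rfl

/-- The GNS construction for a kernel on `I × G` invariant under left translation in `G`. -/
theorem Matrix.PosSemidef.exists_representation {I : Type} {G : Type u} [Group G]
    {K : Matrix (I × G) (I × G) ℝ} (hK : K.PosSemidef)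
    (hinv : ∀ (a : G) i j g h, K (i, a * g) (j, a * h) = K (i, g) (j, h)) :
    ∃ (H : Type u) (_ : NormedAddCommGroup H) (_ : InnerProductSpace ℝ H) (_ : CompleteSpace H)
      (π : G →* (H ≃ₗᵢ[ℝ] H)) (v : I × G → H),
      (∀ a i g, π a (v (i, g)) = v (i, a * g)) ∧ ∀ x y, ⟪v x, v y⟫_ℝ = K x y := by
  obtain ⟨H, _, _, _, v, hv, hg⟩ := hK.exists_gram
  obtain ⟨π, hπ⟩ := exists_representation_of_gram_eq (G := G)
    (w := fun a x => v (x.1, a * x.2)) hv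
    (fun a x y => by rw [hg, hg, hinv]) (by simp)
    (fun a b T hT x => by rw [hT, mul_assoc])
  exact ⟨H, _, _, ‹_›, π, v, fun a i g => hπ a (i, g), hg⟩

/-- The affine GNS construction: a positive semidefinite kernel satisfying the cocycle identity
is the Gram matrix of the orbit of `0` under an affine isometric action. -/
theorem Matrix.PosSemidef.exists_affineAction {G : Type u} [Group G] {K : Matrix G G ℝ}
    (hK : K.PosSemidef)
    (hinv : ∀ a g h, K (a * g) (a * h) - K (a * g) a - K a (a * h) + K a a = K g h) :
    ∃ (H : Type u) (_ : NormedAddCommGroup H) (_ : InnerProductSpace ℝ H) (_ : CompleteSpace H)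
      (σ : G →* (H ≃ᵃⁱ[ℝ] H)), ∀ g, ‖σ g 0‖ ^ 2 = K g g := by
  obtain ⟨H, _, _, _, v, hv, hg⟩ := hK.exists_gram
  have hv1 : v 1 = 0 := by
    rw [← inner_self_eq_zero (𝕜 := ℝ), hg]
    have := hinv 1 1 1
    simp only [mul_one] at this
    linarith
  -- The linear part of `v g ↦ v (a * g)` is `v g ↦ v (a * g) - v a`; the cocycle identity says that
  -- it preserves the Gram matrix.
  obtain ⟨π, hπ⟩ := exists_representation_of_gram_eq (G := G) (w := fun a g => v (a * g) - v a) hv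
    (fun a g h => by
      simp only [inner_sub_left, inner_sub_right, hg, ← hinv a g h]
      ring)
    (by simp [hv1])
    (fun a b T hT g => by simp [hT, mul_assoc])
  refine ⟨H, _, _, ‹_›, {
    toFun := fun g => (π g).toAffineIsometryEquiv.trans (AffineIsometryEquiv.constVAdd ℝ H (v g))
    map_one' := ?_
    map_mul' := fun g h => ?_ }, fun g => ?_⟩
  · ext y
    simp [hv1]
  · ext y
    simp [hπ, map_add, ← add_assoc]
  · rw [← hg, real_inner_self_eq_norm_sq]
    simp

end Kernels

/-! ### Haagerup property against relative Property T -/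

open scoped InnerProductSpace in
/-- A group with the Haagerup property has relative Property T only with respect to finite
subsets. -/
theorem HaagerupProperty.finite_of_relativePropertyT {G : Type u} [Group G] {Y : Set G}
    (hG : HaagerupProperty G) (hT : RelativePropertyT G Y) : Y.Finite := by
  obtain ⟨H₀, _, _, _, σ, hσ⟩ := hG
  have hb : ∀ a g h : G, ‖σ (a * g) 0 - σ (a * h) 0‖ = ‖σ g 0 - σ h 0‖ := by
    intro a g h
    simp only [map_mul, AffineIsometryEquiv.coe_mul, Function.comp_apply, ← dist_eq_norm,
      AffineIsometryEquiv.dist_map]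
  let u : ℕ × G → H₀ := fun x => (√((x.1 : ℝ) + 1))⁻¹ • σ x.2 0
  have hu : ∀ n g h, ‖u (n, g) - u (n, h)‖ ^ 2 = ‖σ g 0 - σ h 0‖ ^ 2 / ((n : ℝ) + 1) := by
    intro n g h
    rw [← smul_sub, norm_smul, mul_pow, norm_inv, Real.norm_of_nonneg (Real.sqrt_nonneg _),
      inv_pow, Real.sq_sqrt (by positivity), inv_mul_eq_div]
  -- The block-diagonal factor makes different scales `n` orthogonal, so one representation carries
  -- all the vectors; across scales the Gaussian kernel need not be invariant.
  obtain ⟨H, _, _, _, π, v, hπ, hv⟩ := ((posSemidef_gaussian u).hadamard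
    (Matrix.PosSemidef.one.submatrix (Prod.fst : ℕ × G → ℕ))).exists_representation (by
      intro a i j g h
      rcases eq_or_ne i j with rfl | hij
      · simp only [Matrix.hadamard_apply, Matrix.of_apply, Matrix.submatrix_apply, hu, hb]
      · simp [Matrix.hadamard_apply, Matrix.one_apply_ne hij])
  have hvn : ∀ n g h, ⟪v (n, g), v (n, h)⟫_ℝ =
      Real.exp (-(‖σ g 0 - σ h 0‖ ^ 2 / ((n : ℝ) + 1))) := fun n g h => by
    simp [hv, Matrix.hadamard_apply, hu]
  have hunit : ∀ n g, ‖v (n, g)‖ = 1 := fun n g => by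
    rw [← sq_eq_sq₀ (norm_nonneg _) zero_le_one, ← real_inner_self_eq_norm_sq, hvn]
    simp
  have hdiff : ∀ n g, ‖π g (v (n, 1)) - v (n, 1)‖ =
      √(2 - 2 * Real.exp (-(‖σ g 0‖ ^ 2 / ((n : ℝ) + 1)))) := fun n g => by
    rw [← Real.sqrt_sq (norm_nonneg (π g (v (n, 1)) - v (n, 1))), hπ, norm_sub_sq_real, hvn,
      hunit, hunit]
    simp only [mul_one, map_one, AffineIsometryEquiv.coe_one, id_eq, sub_zero]
    ring_nf
  have hunif := hT H π (fun n => v (n, 1)) (fun n => hunit n 1) fun g => by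
    simp only [hdiff]
    have hlim : Tendsto (fun n : ℕ => ‖σ g 0‖ ^ 2 / ((n : ℝ) + 1)) atTop (𝓝 0) :=
      tendsto_const_nhds.div_atTop
        (tendsto_atTop_add_const_right _ _ tendsto_natCast_atTop_atTop)
    have h : Continuous fun t : ℝ => √(2 - 2 * Real.exp (-t)) := by fun_prop
    simpa [Function.comp_def] using (h.tendsto 0).comp hlim
  -- At this `n` all of `Y` moves the vector by less than `1`, whereas `‖σ y 0‖ ≥ n + 1` would give
  -- squared displacement at least `2 - 2 / e > 1`.
  obtain ⟨n, hn⟩ := ((Metric.tendstoUniformlyOn_iff.mp hunif) 1 one_pos).exists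
  have hfin := Filter.eventually_cofinite.mp (hσ.eventually_ge_atTop ((n : ℝ) + 1))
  refine hfin.subset fun y hy hle => ?_
  have h1 := hn y hy
  rw [dist_zero_left, norm_norm, hdiff, Real.sqrt_lt' one_pos] at h1
  have h2 : 1 ≤ ‖σ y 0‖ ^ 2 / ((n : ℝ) + 1) := by
    rw [one_le_div (by positivity)]
    nlinarith [n.cast_nonneg (α := ℝ)]
  have h3 : Real.exp (-(‖σ y 0‖ ^ 2 / ((n : ℝ) + 1))) ≤ Real.exp (-1) :=
    Real.exp_le_exp.mpr (neg_le_neg h2)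
  have h4 : Real.exp (-1) < 1 / 2 := by
    rw [Real.exp_neg, inv_eq_one_div]
    exact one_div_lt_one_div_of_lt two_pos (by linarith [Real.add_one_lt_exp one_ne_zero])
  linarith

/-! ### From box space embeddings to affine actions -/

section BoxSpace

open scoped InnerProductSpace Pointwise

/-- Right translation by a fixed group element moves points of all Cayley graphs of quotients along walks
of uniformly bounded length. -/
theorem exists_walk_length_le {G : Type u} [Group G] {S : Set G} {g : G}
    (hg : g ∈ Subgroup.closure S) : ∃ L : ℕ, ∀ (Q : Type u) [Group Q] (f : G →* Q) (x y : Q),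
      y = x * f g → ∃ p : (SimpleGraph.mulCayley (f '' S)).Walk x y, p.length ≤ L := by
  induction hg using Subgroup.closure_induction with
  | mem s hs =>
    refine ⟨1, fun Q _ f x y hxy => ?_⟩
    by_cases h : x = y
    · subst h
      exact ⟨.nil, by simp⟩
    · have hadj : (SimpleGraph.mulCayley (f '' S)).Adj x y :=
        (SimpleGraph.mulCayley_adj' _ _ _).mpr ⟨h, f s, ⟨s, hs, rfl⟩, .inl hxy.symm⟩
      exact ⟨hadj.toWalk, by simp⟩
  | one =>
    refine ⟨0, fun Q _ f x y hxy => ?_⟩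
    obtain rfl : y = x := by simpa using hxy
    exact ⟨.nil, by simp⟩
  | mul a b _ _ iha ihb =>
    obtain ⟨La, ha⟩ := iha
    obtain ⟨Lb, hb⟩ := ihb
    refine ⟨La + Lb, fun Q _ f x y hxy => ?_⟩
    obtain ⟨p, hp⟩ := ha Q f x (x * f a) rfl
    obtain ⟨q, hq⟩ := hb Q f (x * f a) y (by rw [hxy, map_mul, mul_assoc])
    exact ⟨p.append q, by rw [SimpleGraph.Walk.length_append]; omega⟩
  | inv a _ iha =>
    obtain ⟨L, ha⟩ := iha
    refine ⟨L, fun Q _ f x y hxy => ?_⟩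
    obtain ⟨p, hp⟩ := ha Q f y x (by rw [hxy, map_inv, inv_mul_cancel_right])
    exact ⟨p.reverse, by rwa [SimpleGraph.Walk.length_reverse]⟩

/-- The endpoints of a walk in the Cayley graph of a quotient differ by the image of a word of the
length of the walk. -/
theorem exists_mem_pow_of_walk {G Q : Type*} [Group G] [Group Q] {S : Set G} (f : G →* Q)
    {x y : Q} (p : (SimpleGraph.mulCayley (f '' S)).Walk x y) :
    ∃ w ∈ (insert 1 (S ∪ S⁻¹)) ^ p.length, y = x * f w := by
  induction p with
  | nil => exact ⟨1, by simp, by simp⟩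
  | cons h p ih =>
    obtain ⟨w, hw, hxw⟩ := ih
    obtain ⟨-, _, ⟨s, hs, rfl⟩, h | h⟩ := (SimpleGraph.mulCayley_adj' _ _ _).mp h
    · refine ⟨s * w, ?_, by rw [hxw, ← h, map_mul, mul_assoc]⟩
      rw [SimpleGraph.Walk.length_cons, pow_succ']
      exact Set.mul_mem_mul (.inr (.inl hs)) hw
    · refine ⟨s⁻¹ * w, ?_, by rw [hxw, h, map_mul, map_inv, mul_assoc, mul_inv_cancel_left]⟩
      rw [SimpleGraph.Walk.length_cons, pow_succ']
      exact Set.mul_mem_mul (.inr (.inr (Set.inv_mem_inv.mpr hs))) hw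

/-- The average over a finite quotient `Q` of `G` of the Gram kernels of the displacements
`g ↦ φ (x g) - φ x`. -/
noncomputable def averagedKernel {G Q H : Type*} [Group G] [Group Q] [Fintype Q]
    [NormedAddCommGroup H] [InnerProductSpace ℝ H] (f : G →* Q) (φ : Q → H) : Matrix G G ℝ :=
  (Fintype.card Q : ℝ)⁻¹ • ∑ x, Matrix.gram ℝ fun g => φ (x * f g) - φ x

section averagedKernel

variable {G Q H : Type*} [Group G] [Group Q] [Fintype Q] [NormedAddCommGroup H]
  [InnerProductSpace ℝ H] (f : G →* Q) (φ : Q → H)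

theorem averagedKernel_apply (g h : G) : averagedKernel f φ g h =
    (Fintype.card Q : ℝ)⁻¹ * ∑ x, ⟪φ (x * f g) - φ x, φ (x * f h) - φ x⟫_ℝ := by
  simp [averagedKernel, Matrix.sum_apply]

theorem posSemidef_averagedKernel : (averagedKernel f φ).PosSemidef :=
  (Matrix.posSemidef_sum _ fun _ _ => Matrix.posSemidef_gram_real _).smul (by positivity)

/-- The left side averages displacements by `g` and `h` seen from `x * f a`, and `x ↦ x * f a` is a
bijection of `Q`. -/
theorem averagedKernel_cocycle (a g h : G) :
    averagedKernel f φ (a * g) (a * h) - averagedKernel f φ (a * g) a -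
      averagedKernel f φ a (a * h) + averagedKernel f φ a a = averagedKernel f φ g h := by
  simp only [averagedKernel_apply, ← mul_sub, ← mul_add, ← Finset.sum_sub_distrib,
    ← Finset.sum_add_distrib]
  congr 1
  refine Fintype.sum_equiv (Equiv.mulRight (f a)) _ _ fun x => ?_
  simp only [Equiv.coe_mulRight, map_mul, mul_assoc, inner_sub_left, inner_sub_right]
  ring

theorem abs_averagedKernel_le {g h : G} {C D : ℝ} (hg : ∀ x, ‖φ (x * f g) - φ x‖ ≤ C)
    (hh : ∀ x, ‖φ (x * f h) - φ x‖ ≤ D) : |averagedKernel f φ g h| ≤ C * D := by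
  have hC : 0 ≤ C := (norm_nonneg _).trans (hg 1)
  rw [averagedKernel_apply, abs_mul, abs_of_nonneg (by positivity : 0 ≤ (Fintype.card Q : ℝ)⁻¹),
    inv_mul_le_iff₀ (by exact_mod_cast Fintype.card_pos)]
  refine (Finset.abs_sum_le_sum_abs _ _).trans ?_
  refine (Finset.sum_le_card_nsmul _ _ (C * D) fun x _ => ?_).trans ?_
  · exact (abs_real_inner_le_norm _ _).trans
      (mul_le_mul (hg x) (hh x) (norm_nonneg _) hC)
  · simp

theorem exists_norm_sub_lt_of_averagedKernel_lt {g : G} {R : ℝ} (hR : 0 ≤ R)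
    (h : averagedKernel f φ g g < R ^ 2) : ∃ x, ‖φ (x * f g) - φ x‖ < R := by
  by_contra! hle
  rw [averagedKernel_apply, inv_mul_lt_iff₀ (by exact_mod_cast Fintype.card_pos)] at h
  refine h.not_ge ?_
  have := Finset.card_nsmul_le_sum Finset.univ
    (fun x => ⟪φ (x * f g) - φ x, φ (x * f g) - φ x⟫_ℝ) (R ^ 2) fun x _ => by
      rw [real_inner_self_eq_norm_sq]
      exact pow_le_pow_left₀ hR (hle x) 2
  simpa using this

end averagedKernel

/-- If finite quotients of `G`, eventually separating points, carry maps to Hilbert spaces whose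
displacements are bounded above, and below off finite sets, uniformly in the quotient, then `G` has
the Haagerup property. -/
theorem haagerupProperty_of_displacement_bounds {G : Type u} [Group G] {H : Type*}
    [NormedAddCommGroup H] [InnerProductSpace ℝ H] {Q : ℕ → Type*} [∀ n, Group (Q n)]
    [∀ n, Fintype (Q n)] (f : ∀ n, G →* Q n) (φ : ∀ n, Q n → H)
    (hsep : ∀ g h : G, (∃ᶠ n in atTop, f n g = f n h) → g = h)
    (hup : ∀ g, ∃ C : ℝ, ∀ n x, ‖φ n (x * f n g) - φ n x‖ ≤ C)
    (hlow : ∀ R : ℝ, ∃ F : Set G, F.Finite ∧ ∀ n g x, ‖φ n (x * f n g) - φ n x‖ < R →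
      ∃ w ∈ F, f n g = f n w) : HaagerupProperty G := by
  choose C hC using hup
  -- An ultrafilter gives limits for all pairs at once, and later selects a single word out of
  -- finitely many.
  let U : Ultrafilter ℕ := hyperfilter ℕ
  have hU : (U : Filter ℕ) ≤ atTop := Nat.hyperfilter_le_atTop
  have hlim : ∀ g h, ∃ k : ℝ, Tendsto (fun n => averagedKernel (f n) (φ n) g h) U (𝓝 k) := by
    intro g h
    obtain ⟨k, -, hk⟩ := (isCompact_Icc (a := -(C g * C h)) (b := C g * C h)).ultrafilter_le_nhds
      (U.map fun n => averagedKernel (f n) (φ n) g h) (by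
        rw [le_principal_iff]
        exact mem_map.mpr (Filter.univ_mem' fun n => abs_le.mp
          (abs_averagedKernel_le _ _ (hC g n) (hC h n))))
    exact ⟨k, hk⟩
  choose K hK using hlim
  have hpsd : (Matrix.of K).PosSemidef :=
    .of_tendsto (fun n => posSemidef_averagedKernel (f n) (φ n)) hK
  obtain ⟨H', _, _, _, σ, hσ⟩ := hpsd.exists_affineAction fun a g h =>
    tendsto_nhds_unique (((((hK _ _).sub (hK _ _)).sub (hK _ _)).add (hK _ _)).congr fun n =>
      averagedKernel_cocycle (f n) (φ n) a g h) (hK g h)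
  refine ⟨H', _, _, ‹_›, σ, tendsto_atTop.mpr fun R => eventually_cofinite.mpr ?_⟩
  obtain ⟨F, hF, hFR⟩ := hlow R
  refine hF.subset fun g hg => ?_
  rw [Set.mem_ofPred_eq, not_le] at hg
  have hR : 0 ≤ R := (norm_nonneg _).trans hg.le
  have hKg : K g g < R ^ 2 := by
    rw [← Matrix.of_apply K, ← hσ]
    exact pow_lt_pow_left₀ hg (norm_nonneg _) two_ne_zero
  have hev : ∀ᶠ n in U, ∃ w ∈ F, f n g = f n w := by
    filter_upwards [(hK g g).eventually_lt_const hKg] with n hn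
    obtain ⟨x, hx⟩ := exists_norm_sub_lt_of_averagedKernel_lt _ _ hR hn
    exact hFR n g x hx
  have hmem : (⋃ w ∈ F, {n | f n g = f n w}) ∈ U := by
    filter_upwards [hev] with n hn
    simpa using hn
  obtain ⟨w, hw, hwU⟩ := (Ultrafilter.finite_biUnion_mem_iff hF).mp hmem
  obtain rfl := hsep g w ((Ultrafilter.frequently_iff_eventually.mpr hwU).filter_mono hU)
  exact hw

/-- A finitely generated group with a box space embedding coarsely into a Hilbert space has the
Haagerup property. -/
theorem BoxSpaceEmbedsInHilbert.haagerupProperty {G : Type u} [Group G] {S : Set G}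
    (hSfin : S.Finite) (hSgen : Subgroup.closure S = ⊤) {N : ℕ → Subgroup G}
    [∀ n, (N n).Normal] (hN : IsBoxSequence N) (h : BoxSpaceEmbedsInHilbert.{u, w} S N) :
    HaagerupProperty G := by
  obtain ⟨H, _, _, _, φ, ρ, γ, hρ, -, hφ⟩ := h
  have hfin := hN.finiteIndex
  have (n : ℕ) : Fintype (G ⧸ N n) := Subgroup.fintypeQuotientOfFiniteIndex
  have hwalk := fun g : G => exists_walk_length_le (S := S) (g := g) (hSgen ▸ Subgroup.mem_top g)
  choose L hL using hwalk
  -- `γ` need not be monotone, so its values at all distances up to `L g` are summed.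
  refine haagerupProperty_of_displacement_bounds (fun n => QuotientGroup.mk' (N n)) φ
    (fun g h hfr => ?_) (fun g => ⟨∑ l ∈ Finset.range (L g + 1), γ l, fun n x => ?_⟩) fun R => ?_
  · have hmem : g⁻¹ * h ∈ ⨅ n, N n := by
      rw [Subgroup.mem_iInf]
      intro n
      obtain ⟨m, hnm, hm⟩ := frequently_atTop.mp hfr n
      exact hN.nested hnm (QuotientGroup.eq.mp hm)
    rw [hN.iInf_eq_bot, Subgroup.mem_bot, inv_mul_eq_one] at hmem
    exact hmem
  · obtain ⟨p, hp⟩ := hL g (G ⧸ N n) (QuotientGroup.mk' (N n)) x _ rfl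
    have hd : boxSpaceDist S N n x (x * QuotientGroup.mk' (N n) g) ≤ L g :=
      (SimpleGraph.dist_le p).trans hp
    have hle := (hφ n x (x * QuotientGroup.mk' (N n) g)).2.trans
      (Finset.single_le_sum (f := fun l : ℕ => γ l) (fun _ _ => zero_le)
        (Finset.mem_range.mpr (Nat.lt_succ_of_le hd)))
    rw [← dist_eq_norm, dist_comm, ← coe_nndist]
    exact_mod_cast hle
  · obtain ⟨D, hD⟩ := (hρ.eventually_ge_atTop R.toNNReal).exists_forall_of_atTop
    have hT : (insert 1 (S ∪ S⁻¹) : Set G).Finite := (hSfin.union hSfin.inv).insert 1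
    have hpow : ∀ m : ℕ, ((insert 1 (S ∪ S⁻¹) : Set G) ^ m).Finite := fun m => by
      induction m with
      | zero => simp
      | succ m ih => exact pow_succ (insert 1 (S ∪ S⁻¹)) m ▸ ih.mul hT
    refine ⟨(insert 1 (S ∪ S⁻¹)) ^ ⌈D⌉₊, hpow _, fun n g x hlt => ?_⟩
    -- Only reachability is needed here: `dist` is `0` between unreachable points, so a geodesic
    -- exists only once some walk does.
    obtain ⟨p, -⟩ := hL g (G ⧸ N n) (QuotientGroup.mk' (N n)) x _ rfl
    obtain ⟨q, hq⟩ := p.reachable.exists_walk_length_eq_dist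
    obtain ⟨w, hw, hxw⟩ := exists_mem_pow_of_walk _ q
    -- Including `1` among the letters makes the powers increase, so a geodesic of length at most
    -- `⌈D⌉₊` suffices.
    refine ⟨w, Set.pow_subset_pow_right (Set.mem_insert _ _) ?_ hw, mul_left_cancel hxw⟩
    by_contra! hlen
    have hDd : D ≤ (boxSpaceDist S N n x (x * QuotientGroup.mk' (N n) g) : ℝ≥0) := by
      refine (Nat.le_ceil D).trans ?_
      rw [hq] at hlen
      exact_mod_cast hlen.le
    have hle := (hD _ hDd).trans (hφ n x _).1
    rw [Real.toNNReal_le_iff_le_coe, coe_nndist, dist_comm, dist_eq_norm] at hle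
    exact hlt.not_ge hle

end BoxSpace

theorem mainTheorem9 (G : Type u) [Group G] (S : Set G) (hSfin : S.Finite)
    (hSgen : Subgroup.closure S = ⊤) :
    (¬ HaagerupProperty G →
      ∀ (N : ℕ → Subgroup G) [∀ n, (N n).Normal], IsBoxSequence N →
        ¬ BoxSpaceEmbedsInHilbert.{u, w} S N) ∧
    ((∃ Y : Set G, Y.Infinite ∧ RelativePropertyT G Y) →
      ∀ (N : ℕ → Subgroup G) [∀ n, (N n).Normal], IsBoxSequence N →
        ¬ BoxSpaceEmbedsInHilbert.{u, w} S N) := by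
  refine ⟨fun hG N _ hN h => hG (h.haagerupProperty hSfin hSgen hN), ?_⟩
  rintro ⟨Y, hY, hT⟩ N _ hN h
  exact hY (HaagerupProperty.finite_of_relativePropertyT (h.haagerupProperty hSfin hSgen hN) hT)
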